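/- Let $\kappa$ be a regular cardinal and let $\mathsf A$ be a $\kappa$-accessible category, i.e. a category with $\kappa$-directed colimits that has a set $\mathsf S$ of $\kappa$-presentable objects such that every object of $\mathsf A$ is a $\kappa$-directed colimit of objects from $\mathsf S$. Let $\mathsf A_{<\kappa}\subset\mathsf A$ be the full subcategory of all $\kappa$-presentable objects, and for a category $\mathsf C$ let $\mathsf C^\to$ be the category of morphisms of $\mathsf C$. A class $\mathcal M$ of morphisms in a category $\mathsf C$ is called a *QE-mono class* if 1. for every $m\colon C\to D$ in $\mathcal M$ and every morphism $f\colon C\to C'$ in $\mathsf C$, the pushout $D'=C'\sqcup_C D$ exists in $\mathsf C$, and the morphism $m'\colon C'\to D'$ belongs to $\mathcal M$; 2. every $m\in\mathcal M$ is the equalizer of its cokernel pair (the pushout of $m$ along itself); 3. all identity morphisms belong to $\mathcal M$, and $\mathcal M$ is closed under composition. Given a QE-mono class $\mathcal M$, an *$\mathcal M$-sequence* is a diagram $C\xrightarrow{m}D\rightrightarrows K$ where $m\in\mathcal M$ and $D\rightrightarrows K$ is a cokernel pair of $m$. Let $J$ be the category with three objects $1,2,3$ and four nonidentity morphisms: $1\to2$,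 a parallel pair $2\rightrightarrows3$, and $1\to3$, both compositions $1\to 2\rightrightarrows 3$ being equal to the morphism $1\to3$. So $\mathcal M$-sequences are objects of the category $\mathsf C^J$ of $J$-shaped diagrams in $\mathsf C$. A QE-mono class $\mathcal M$ in $\mathsf A$ is called *locally $\kappa$-coherent* if the $\mathcal M$-sequences are precisely all the $\kappa$-directed colimits, taken in $\mathsf A^J$, of $\mathcal M$-sequences with all three terms $C,D,K$ belonging to $\mathsf A_{<\kappa}$. For a class $\mathcal N$ of morphisms in $\mathsf A_{<\kappa}$, let $\varinjlim_{(\kappa)}\mathcal N$ be the class of all morphisms of $\mathsf A$ that are $\kappa$-directed colimits, taken in $\mathsf A^\to$, of morphisms from $\mathcal N$. For a class $\mathcal M$ of morphisms in $\mathsf A$, let $\mathcal M\cap\mathsf A_{<\kappa}^\to$ be the class of all morphisms from $\mathcal M$ whose domain and codomain are $\kappa$-presentable. Then there is a bijective correspondence between locally $\kappa$-coherent QE-mono classes $\mathcal M$ in $\mathsf A$ and those QE-mono classes $\mathcal N$ in the category $\mathsf A_{<\kappa}$ that are closed under retracts in $\mathsf A_{<\kappa}^\to$. The bijection assigns to every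 locally $\kappa$-coherent QE-mono class $\mathcal M$ in $\mathsf A$ the class $\mathcal N=\mathcal M\cap\mathsf A_{<\kappa}^\to$, which is a QE-mono class in $\mathsf A_{<\kappa}$ closed under retracts. The inverse bijection assigns to every QE-mono class $\mathcal N$ in $\mathsf A_{<\kappa}$ closed under retracts the class $\mathcal M=\varinjlim_{(\kappa)}\mathcal N$, which is a locally $\kappa$-coherent QE-mono class in $\mathsf A$. -/

import Mathlib

open CategoryTheory Limits

universe w v u

/-- A class `M` of morphisms in `C` is a QE-mono class if (i) pushouts of all morphisms from `M`
along arbitrary morphisms exist and belong to `M`; (ii) every morphism from `M` is the equalizer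
of its cokernel pair; (iii) `M` contains the identities and is closed under composition. -/
structure IsQEMonoClass {C : Type u} [Category.{v} C] (M : MorphismProperty C) : Prop where
  hasPushout : ∀ {X Y X' : C} (m : X ⟶ Y) (f : X ⟶ X'), M m → HasPushout m f
  /-- `M` is stable under pushouts; the pushout is any object with the universal property. -/
  pushout_mem : ∀ {X Y X' Y' : C} {m : X ⟶ Y} {f : X ⟶ X'} {f' : Y ⟶ Y'} {m' : X' ⟶ Y'},
    IsPushout m f f' m' → M m → M m'
  /-- For a cokernel pair `(k₁, k₂)` of `m ∈ M`, the morphism `m` is an equalizer of `k₁, k₂`. -/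
  isEqualizer : ∀ {X Y K : C} {m : X ⟶ Y} {k₁ k₂ : Y ⟶ K} (sq : IsPushout m m k₁ k₂),
    M m → Nonempty (IsLimit (Fork.ofι m sq.w))
  id_mem : ∀ X : C, M (𝟙 X)
  comp_mem : ∀ {X Y Z : C} (f : X ⟶ Y) (g : Y ⟶ Z), M f → M g → M (f ≫ g)

/-- The objects of `C` that are colimits of diagrams of objects satisfying `P` indexed by small
`κ`-directed posets. (For a poset, being `κ`-filtered as a category means that every subset of
cardinality less than `κ` has an upper bound.) -/
def directedColimits {C : Type u} [Category.{v} C] (κ : Cardinal.{w}) [Fact κ.IsRegular]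
    (P : ObjectProperty C) : ObjectProperty C := fun X =>
  ∃ (J : Type w) (_ : PartialOrder J) (_ : IsCardinalFiltered J κ), P.colimitsOfShape J X

/-- The three objects of the category indexing diagrams `C ⟶ D ⇉ K` in which both compositions
are equal. -/
inductive SeqShape : Type
  | one
  | two
  | three

namespace SeqShape

/-- Besides the identities there are four morphisms: `one ⟶ two`, a parallel pair
`two ⇉ three`, and a single morphism `one ⟶ three`. -/
inductive Hom : SeqShape → SeqShape → Type
  | id (X : SeqShape) : Hom X X
  | m : Hom one two
  | k₁ : Hom two three
  | k₂ : Hom two three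
  | c : Hom one three

/-- Both compositions `one ⟶ two ⇉ three` are equal to the morphism `one ⟶ three`. -/
def Hom.comp : {X Y Z : SeqShape} → Hom X Y → Hom Y Z → Hom X Z
  | _, _, _, .id _, g => g
  | _, _, _, .m, .id _ => .m
  | _, _, _, .m, .k₁ => .c
  | _, _, _, .m, .k₂ => .c
  | _, _, _, .k₁, .id _ => .k₁
  | _, _, _, .k₂, .id _ => .k₂
  | _, _, _, .c, .id _ => .c

instance : SmallCategory SeqShape where
  Hom := Hom
  id := Hom.id
  comp := Hom.comp
  id_comp _ := rfl
  comp_id f := by cases f <;> rfl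
  assoc f g h := by cases f <;> cases g <;> cases h <;> rfl

/-- The morphism `one ⟶ two`. -/
def homM : one ⟶ two := Hom.m

/-- The first of the two parallel morphisms `two ⇉ three`. -/
def homK₁ : two ⟶ three := Hom.k₁

/-- The second of the two parallel morphisms `two ⇉ three`. -/
def homK₂ : two ⟶ three := Hom.k₂

end SeqShape

/-- The `M`-sequences: the diagrams `C ⟶ D ⇉ K`, as objects of the category of functors
`SeqShape ⥤ A`, formed by a morphism `C ⟶ D` belonging to `M` and a cokernel pair of it. -/
def isMSequence {A : Type u} [Category.{v} A] (M : MorphismProperty A) :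
    ObjectProperty (SeqShape ⥤ A) := fun F =>
  M (F.map SeqShape.homM) ∧
    IsPushout (F.map SeqShape.homM) (F.map SeqShape.homM)
      (F.map SeqShape.homK₁) (F.map SeqShape.homK₂)

/-- `M` is locally `κ`-coherent if the `M`-sequences are precisely the `κ`-directed colimits, in
the diagram category, of `M`-sequences all of whose terms are `κ`-presentable. (This notion is
meant for QE-mono classes in `κ`-accessible categories.) -/
def IsLocallyCoherent {A : Type u} [Category.{v} A] (κ : Cardinal.{w}) [Fact κ.IsRegular]
    (M : MorphismProperty A) : Prop :=
  isMSequence M = directedColimits κ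
    (fun F => isMSequence M F ∧ ∀ j : SeqShape, isCardinalPresentable A κ (F.obj j))

/-- The full subcategory of `κ`-presentable objects of `A`. -/
abbrev PresentableObjects (A : Type u) [Category.{v} A] (κ : Cardinal.{w}) [Fact κ.IsRegular] :
    Type u :=
  (isCardinalPresentable A κ).FullSubcategory

/-- The class of all morphisms between `κ`-presentable objects that belong to `M`, as a class of
morphisms in the full subcategory of `κ`-presentable objects. -/
def restrictToPresentable {A : Type u} [Category.{v} A] (κ : Cardinal.{w}) [Fact κ.IsRegular]
    (M : MorphismProperty A) : MorphismProperty (PresentableObjects A κ) :=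
  M.inverseImage (isCardinalPresentable A κ).ι

/-- The class of all `κ`-directed colimits, taken in the category of morphisms of `A`, of
morphisms from a class `N` of morphisms between `κ`-presentable objects. -/
def directedColimitsOfMorphisms {A : Type u} [Category.{v} A] (κ : Cardinal.{w})
    [Fact κ.IsRegular] (N : MorphismProperty (PresentableObjects A κ)) : MorphismProperty A :=
  fun _ _ f => directedColimits κ
    (fun g : Arrow A => ∃ (hl : isCardinalPresentable A κ g.left)
      (hr : isCardinalPresentable A κ g.right),
      N (ObjectProperty.homMk g.hom :
        (⟨g.left, hl⟩ : PresentableObjects A κ) ⟶ ⟨g.right, hr⟩))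
    (Arrow.mk f)

/-! The core is a factorization criterion, `directedColimitsOfMorphisms_iff_factors`: `f` is a
`κ`-directed colimit of members of `N` iff every map to `f` in `Arrow A`, from an arrow with
`κ`-presentable ends, factors through a member of `N`. Such arrows are `κ`-presentable in `Arrow A`,
which gives one direction. Conversely, every arrow is a `κ`-filtered colimit of such arrows, and if
the criterion holds, the members of `N` over `f` are cofinal among the `κ`-presentable arrows over
`f`.

Applied to the identity of an `f` between `κ`-presentables, the criterion exhibits `f` as a retract
of a member of `N`; so closure under retracts is what recovers `N` from its colimits. The criterion
also yields closure under retracts of `M ∩ A_{<κ}^→`, and, with one pushout, closure of the colimits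
of `N` under composition.

The other axioms pass to colimits because colimits commute with pushouts, because pushouts in
`A_{<κ}` are pushouts in `A` (`isPushout_map_ι`), and because equalizers can be tested on
`κ`-presentable objects and so commute with `κ`-filtered colimits (`isLimit_fork_of_isColimit`).
Forming cokernel pairs termwise turns a presentation of a morphism into one of its whole sequence,
and forgetting the third term goes back; this links local coherence with `M` being generated by its
`κ`-presentable part. -/

namespace CategoryTheory

/-! ### Filteredness of comma categories -/

/-- If `R` is final and `A`, `B` are `κ`-filtered, then `Comma L R` is `κ`-filtered. -/
lemma Comma.isCardinalFiltered_of_final {A B T : Type*} [Category* A] [Category* B] [Category* T]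
    (L : A ⥤ T) (R : B ⥤ T) (κ : Cardinal.{w}) [Fact κ.IsRegular] [IsCardinalFiltered A κ]
    [IsCardinalFiltered B κ] [R.Final] : IsCardinalFiltered (Comma L R) κ where
  nonempty_cocone {D _} F hD := ⟨by
    have := isFiltered_of_isCardinalFiltered B κ
    let ca := IsCardinalFiltered.cocone (F ⋙ Comma.fst L R) hD
    let cb := IsCardinalFiltered.cocone (F ⋙ Comma.snd L R) hD
    have h₁ := ((Functor.final_iff_of_isFiltered R).1 inferInstance).1 (L.obj ca.pt)
    let b₁ := h₁.choose
    let u : L.obj ca.pt ⟶ R.obj b₁ := h₁.choose_spec.some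
    let b₂ := IsFiltered.max b₁ cb.pt
    let l : b₁ ⟶ b₂ := IsFiltered.leftToMax _ _
    let r : cb.pt ⟶ b₂ := IsFiltered.rightToMax _ _
    -- The two routes from `L` of the left component of `F.obj d` to `R.obj b₂` need not agree;
    -- finality makes them agree further on, at a stage depending on `d`.
    have h₂ (d : D) : ∃ (b' : B) (t : b₂ ⟶ b'),
        (L.map (ca.ι.app d) ≫ u ≫ R.map l) ≫ R.map t =
          ((F.obj d).hom ≫ R.map (cb.ι.app d) ≫ R.map r) ≫ R.map t :=
      Functor.Final.exists_coeq R _ _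
    choose b' t ht using h₂
    -- There are fewer than `κ` indices `d`, so one morphism `s` out of `b₂` factors through every
    -- `t d`.
    have h₃ := IsCardinalFiltered.wideSpan t (hasCardinalLT_of_hasCardinalLT_arrow hD)
    let b₃ := h₃.choose
    let s : b₂ ⟶ b₃ := h₃.choose_spec.choose_spec.choose
    have hs (d : D) : ∃ a : b' d ⟶ b₃, t d ≫ a = s :=
      ⟨_, h₃.choose_spec.choose_spec.choose_spec d⟩
    exact
      { pt := ⟨ca.pt, b₃, u ≫ R.map (l ≫ s)⟩
        ι :=
          { app d :=
              { left := ca.ι.app d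
                right := cb.ι.app d ≫ r ≫ s
                w := by
                  obtain ⟨a, ha⟩ := hs d
                  have := ht d =≫ R.map a
                  simp only [Category.assoc] at this
                  simp only [Functor.const_obj_obj, Functor.map_comp, ← ha]
                  exact this }
            naturality d d' g := by
              ext
              · simpa using ca.w g
              · have : (F.map g).right ≫ cb.ι.app d' = cb.ι.app d := cb.w g
                simp [reassoc_of% this] } }⟩

/-! ### Pushouts commute with colimits -/

/-- `C` need not have all pushouts, so the functor is assembled from the universal properties of the
pointwise ones. -/
lemma IsPushout.exists_functor {K C : Type*} [Category* K] [Category* C] {S T U : K ⥤ C}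
    (m : S ⟶ T) (f : S ⟶ U) (h : ∀ k, HasPushout (m.app k) (f.app k)) :
    ∃ (P : K ⥤ C) (i : T ⟶ P) (j : U ⟶ P),
      ∀ k, IsPushout (m.app k) (f.app k) (i.app k) (j.app k) := by
  have sq (k : K) := IsPushout.of_hasPushout (m.app k) (f.app k)
  refine ⟨
    { obj k := pushout (m.app k) (f.app k)
      map {k k'} g := (sq k).desc (T.map g ≫ pushout.inl _ _) (U.map g ≫ pushout.inr _ _) (by
        rw [← m.naturality_assoc, ← f.naturality_assoc, pushout.condition])
      map_id k := (sq k).hom_ext (by simp) (by simp)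
      map_comp g g' := (sq _).hom_ext (by simp) (by simp) },
    { app k := pushout.inl _ _ }, { app k := pushout.inr _ _ }, sq⟩

/-- Pushout squares are preserved by arbitrary colimits. -/
lemma IsPushout.of_isColimit_app {K C : Type*} [Category* K] [Category* C] {S T U P : K ⥤ C}
    {m : S ⟶ T} {f : S ⟶ U} {i : T ⟶ P} {j : U ⟶ P}
    (h : ∀ k, IsPushout (m.app k) (f.app k) (i.app k) (j.app k))
    {cS : Cocone S} {cT : Cocone T} {cU : Cocone U} {cP : Cocone P}
    (hS : IsColimit cS) (hT : IsColimit cT) (hU : IsColimit cU) (hP : IsColimit cP)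
    {m' : cS.pt ⟶ cT.pt} {f' : cS.pt ⟶ cU.pt} {i' : cT.pt ⟶ cP.pt} {j' : cU.pt ⟶ cP.pt}
    (hm : ∀ k, cS.ι.app k ≫ m' = m.app k ≫ cT.ι.app k)
    (hf : ∀ k, cS.ι.app k ≫ f' = f.app k ≫ cU.ι.app k)
    (hi : ∀ k, cT.ι.app k ≫ i' = i.app k ≫ cP.ι.app k)
    (hj : ∀ k, cU.ι.app k ≫ j' = j.app k ≫ cP.ι.app k) :
    IsPushout m' f' i' j' where
  w := hS.hom_ext fun k ↦ by
    rw [reassoc_of% hm k, reassoc_of% hf k, hi, hj, (h k).w_assoc]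
  isColimit' := by
    have key (s : PushoutCocone m' f') (k : K) :
        m.app k ≫ cT.ι.app k ≫ s.inl = f.app k ≫ cU.ι.app k ≫ s.inr := by
      rw [← reassoc_of% hm k, ← reassoc_of% hf k, s.condition]
    let c (s : PushoutCocone m' f') : Cocone P :=
      { pt := s.pt
        ι :=
          { app k := (h k).desc (cT.ι.app k ≫ s.inl) (cU.ι.app k ≫ s.inr) (key s k)
            naturality k k' g := (h k).hom_ext
              (by simp [← i.naturality_assoc])
              (by simp [← j.naturality_assoc]) } }
    refine ⟨PushoutCocone.IsColimit.mk _ (fun s ↦ hP.desc (c s)) (fun s ↦ ?_) (fun s ↦ ?_)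
      (fun s d hd₁ hd₂ ↦ ?_)⟩
    · exact hT.hom_ext fun k ↦ by simp [reassoc_of% hi k, c]
    · exact hU.hom_ext fun k ↦ by simp [reassoc_of% hj k, c]
    · refine hP.hom_ext fun k ↦ (h k).hom_ext ?_ ?_
      · simp [c, ← reassoc_of% hi k, hd₁]
      · simp [c, ← reassoc_of% hj k, hd₂]

/-- The source of pushouts in `A`: the colimit of the termwise pushouts is a pushout of the
colimits. -/
lemma IsPushout.hasPushout_of_isColimit {K C : Type*} [Category* K] [Category* C]
    {S T U P : K ⥤ C} [HasColimit P] {m : S ⟶ T} {f : S ⟶ U} {i : T ⟶ P} {j : U ⟶ P}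
    (h : ∀ k, IsPushout (m.app k) (f.app k) (i.app k) (j.app k))
    {cS : Cocone S} {cT : Cocone T} {cU : Cocone U}
    (hS : IsColimit cS) (hT : IsColimit cT) (hU : IsColimit cU)
    {m' : cS.pt ⟶ cT.pt} {f' : cS.pt ⟶ cU.pt}
    (hm : ∀ k, cS.ι.app k ≫ m' = m.app k ≫ cT.ι.app k)
    (hf : ∀ k, cS.ι.app k ≫ f' = f.app k ≫ cU.ι.app k) : HasPushout m' f' :=
  (IsPushout.of_isColimit_app h hS hT hU (colimit.isColimit P)
    (i' := hT.desc ((Cocone.precompose i).obj (colimit.cocone P)))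
    (j' := hU.desc ((Cocone.precompose j).obj (colimit.cocone P))) hm hf
    (fun k ↦ hT.fac _ k) (fun k ↦ hU.fac _ k)).hasPushout

/-- The pushout of the colimits is a colimit of the pushouts. -/
lemma IsPushout.exists_isColimit {K C : Type*} [Category* K] [Category* C]
    {S T U P : K ⥤ C} {m : S ⟶ T} {f : S ⟶ U} {i : T ⟶ P} {j : U ⟶ P}
    (h : ∀ k, IsPushout (m.app k) (f.app k) (i.app k) (j.app k))
    {cS : Cocone S} {cT : Cocone T} {cU : Cocone U}
    (hS : IsColimit cS) (hT : IsColimit cT) (hU : IsColimit cU)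
    {m' : cS.pt ⟶ cT.pt} {f' : cS.pt ⟶ cU.pt} {Z : C} {i' : cT.pt ⟶ Z} {j' : cU.pt ⟶ Z}
    (sq : IsPushout m' f' i' j')
    (hm : ∀ k, cS.ι.app k ≫ m' = m.app k ≫ cT.ι.app k)
    (hf : ∀ k, cS.ι.app k ≫ f' = f.app k ≫ cU.ι.app k) :
    ∃ (ι : P ⟶ (Functor.const K).obj Z) (_ : IsColimit (Cocone.mk Z ι)),
      (∀ k, cT.ι.app k ≫ i' = i.app k ≫ ι.app k) ∧
        ∀ k, cU.ι.app k ≫ j' = j.app k ≫ ι.app k := by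
  let ι : P ⟶ (Functor.const K).obj Z :=
    { app k := (h k).desc (cT.ι.app k ≫ i') (cU.ι.app k ≫ j')
        (by rw [← reassoc_of% hm k, ← reassoc_of% hf k, sq.w])
      naturality k k' g := (h k).hom_ext
        (by simp [← i.naturality_assoc]) (by simp [← j.naturality_assoc]) }
  have h₁ (k : K) : i.app k ≫ ι.app k = cT.ι.app k ≫ i' := (h k).inl_desc _ _ _
  have h₂ (k : K) : j.app k ≫ ι.app k = cU.ι.app k ≫ j' := (h k).inr_desc _ _ _
  let a (s : Cocone P) : cT.pt ⟶ s.pt := hT.desc ((Cocone.precompose i).obj s)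
  let b (s : Cocone P) : cU.pt ⟶ s.pt := hU.desc ((Cocone.precompose j).obj s)
  have ha (s : Cocone P) (k : K) : cT.ι.app k ≫ a s = i.app k ≫ s.ι.app k := hT.fac _ k
  have hb (s : Cocone P) (k : K) : cU.ι.app k ≫ b s = j.app k ≫ s.ι.app k := hU.fac _ k
  have hab (s : Cocone P) : m' ≫ a s = f' ≫ b s := hS.hom_ext fun k ↦ by
    rw [reassoc_of% hm k, reassoc_of% hf k, ha, hb, (h k).w_assoc]
  refine ⟨ι,
    { desc s := sq.desc (a s) (b s) (hab s)
      fac s k := (h k).hom_ext ?_ ?_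
      uniq s d hd := sq.hom_ext (hT.hom_ext fun k ↦ ?_) (hU.hom_ext fun k ↦ ?_) },
    fun k ↦ (h₁ k).symm, fun k ↦ (h₂ k).symm⟩
  · simp [reassoc_of% h₁ k, ha]
  · simp [reassoc_of% h₂ k, hb]
  · dsimp at hd ⊢
    rw [← reassoc_of% h₁ k, hd, sq.inl_desc, ha]
  · dsimp at hd ⊢
    rw [← reassoc_of% h₂ k, hd, sq.inr_desc, hb]

/-! ### Colimits and presentability in the arrow category -/

section Arrow

variable {C : Type u} [Category.{v} C] {J : Type*} [Category* J]

/-- A cocone in `Arrow C` is a colimit if its images in `C` under the domain and codomain functors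
are colimits. -/
noncomputable def Arrow.isColimitOfLeftRight {F : J ⥤ Arrow C} {c : Cocone F}
    (hl : IsColimit (Arrow.leftFunc.mapCocone c)) (hr : IsColimit (Arrow.rightFunc.mapCocone c)) :
    IsColimit c :=
  Comma.fstSndJointlyReflectColimit (L := 𝟭 C) (R := 𝟭 C) hl hr

/-- A colimit presentation of a morphism from colimit presentations of its domain and codomain. -/
noncomputable def Arrow.colimitPresentation {S T : J ⥤ C} (m : S ⟶ T) {cS : Cocone S}
    {cT : Cocone T} (hS : IsColimit cS) (hT : IsColimit cT) {m' : cS.pt ⟶ cT.pt}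
    (hm : ∀ j, cS.ι.app j ≫ m' = m.app j ≫ cT.ι.app j) :
    ColimitPresentation J (Arrow.mk m') where
  diag :=
    { obj j := Arrow.mk (m.app j)
      map g := Arrow.homMk (S.map g) (T.map g) (m.naturality g) }
  ι :=
    { app j := Arrow.homMk (cS.ι.app j) (cT.ι.app j) (hm j)
      naturality j j' g := by
        ext
        · exact cS.ι.naturality g
        · exact cT.ι.naturality g }
  isColimit := Arrow.isColimitOfLeftRight hS hT

/-- The colimit presentation of the domain of a morphism induced by one of the morphism. -/
noncomputable def Limits.ColimitPresentation.left [HasColimitsOfShape J C] {X Y : C} {f : X ⟶ Y}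
    (p : ColimitPresentation J (Arrow.mk f)) : ColimitPresentation J X where
  diag := p.diag ⋙ Arrow.leftFunc
  ι :=
    { app j := (p.ι.app j).left
      naturality _ _ g := congr_arg (fun t ↦ t.left) (p.ι.naturality g) }
  isColimit := isColimitOfPreserves Arrow.leftFunc p.isColimit

/-- The colimit presentation of the codomain of a morphism induced by one of the morphism. -/
noncomputable def Limits.ColimitPresentation.right [HasColimitsOfShape J C] {X Y : C} {f : X ⟶ Y}
    (p : ColimitPresentation J (Arrow.mk f)) : ColimitPresentation J Y where
  diag := p.diag ⋙ Arrow.rightFunc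
  ι :=
    { app j := (p.ι.app j).right
      naturality _ _ g := congr_arg (fun t ↦ t.right) (p.ι.naturality g) }
  isColimit := isColimitOfPreserves Arrow.rightFunc p.isColimit

variable {κ : Cardinal.{w}} [Fact κ.IsRegular]

/-- `κ`-filtered colimits of arrows are computed on domains and codomains since they exist in `C`. A
map from `g` to the colimit lifts componentwise, and the lifted square commutes at a later stage
because `g.left` is presentable. -/
lemma Arrow.isCardinalPresentable [HasCardinalFilteredColimits.{w} C κ] (g : Arrow C)
    [IsCardinalPresentable g.left κ] [IsCardinalPresentable g.right κ] :
    IsCardinalPresentable g κ where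
  preservesColimitOfShape J _ _ := ⟨fun {F} ↦ ⟨fun {c} hc ↦ ⟨by
    have := essentiallySmallSelf J
    have := isFiltered_of_isCardinalFiltered J κ
    have := HasCardinalFilteredColimits.hasColimitsOfShape C κ J
    have hl := isColimitOfPreserves Arrow.leftFunc hc
    have hr := isColimitOfPreserves Arrow.rightFunc hc
    refine Types.FilteredColimit.isColimitOf' _ _ (fun f ↦ ?_) (fun j f₁ f₂ hf ↦ ?_)
    · change g ⟶ c.pt at f
      obtain ⟨i₁, a, ha⟩ : ∃ (i : J) (a : g.left ⟶ (F.obj i).left),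
          a ≫ (c.ι.app i).left = f.left :=
        IsCardinalPresentable.exists_hom_of_isColimit κ hl f.left
      obtain ⟨i₂, b, hb⟩ : ∃ (i : J) (b : g.right ⟶ (F.obj i).right),
          b ≫ (c.ι.app i).right = f.right :=
        IsCardinalPresentable.exists_hom_of_isColimit κ hr f.right
      obtain ⟨k, u, v, huv⟩ : ∃ (k : J) (u : i₁ ⟶ k) (v : i₂ ⟶ k),
          (a ≫ (F.obj i₁).hom) ≫ (F.map u).right = (g.hom ≫ b) ≫ (F.map v).right :=
        IsCardinalPresentable.exists_eq_of_isColimit κ hr _ _ (by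
          change (a ≫ (F.obj i₁).hom) ≫ (c.ι.app i₁).right = (g.hom ≫ b) ≫ (c.ι.app i₂).right
          have h₁ := Arrow.w (c.ι.app i₁)
          have h₂ := Arrow.w f
          dsimp at h₁ h₂
          rw [Category.assoc, Category.assoc, hb, ← h₂, ← h₁, ← ha, Category.assoc])
      refine ⟨k, Arrow.homMk (a ≫ (F.map u).left) (b ≫ (F.map v).right) ?_, ?_⟩
      · have := Arrow.w (F.map u)
        simp only [Category.assoc] at huv ⊢
        rw [← huv, this]
      · change f = _ ≫ c.ι.app k
        have h₁ : (F.map u).left ≫ (c.ι.app k).left = (c.ι.app i₁).left :=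
          congr_arg CommaMorphism.left (c.w u)
        have h₂ : (F.map v).right ≫ (c.ι.app k).right = (c.ι.app i₂).right :=
          congr_arg CommaMorphism.right (c.w v)
        ext
        · change f.left = (a ≫ (F.map u).left) ≫ (c.ι.app k).left
          rw [Category.assoc, h₁, ha]
        · change f.right = (b ≫ (F.map v).right) ≫ (c.ι.app k).right
          rw [Category.assoc, h₂, hb]
    · change g ⟶ F.obj j at f₁ f₂
      replace hf : f₁ ≫ c.ι.app j = f₂ ≫ c.ι.app j := hf
      obtain ⟨k₁, u₁, h₁⟩ : ∃ (k : J) (u : j ⟶ k),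
          f₁.left ≫ (F.map u).left = f₂.left ≫ (F.map u).left :=
        IsCardinalPresentable.exists_eq_of_isColimit' κ hl f₁.left f₂.left
          (congr_arg CommaMorphism.left hf)
      obtain ⟨k₂, u₂, h₂⟩ : ∃ (k : J) (u : j ⟶ k),
          f₁.right ≫ (F.map u).right = f₂.right ≫ (F.map u).right :=
        IsCardinalPresentable.exists_eq_of_isColimit' κ hr f₁.right f₂.right
          (congr_arg CommaMorphism.right hf)
      obtain ⟨k, v₁, v₂, hv⟩ := IsFiltered.span u₁ u₂
      refine ⟨k, u₁ ≫ v₁, ?_⟩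
      change f₁ ≫ F.map _ = f₂ ≫ F.map _
      ext
      · simp [reassoc_of% h₁]
      · simp [hv, reassoc_of% h₂]⟩⟩⟩

end Arrow

/-! ### Changing the shape of filtered colimits -/

section

variable {C : Type u} [Category.{v} C] {κ : Cardinal.{w}} [Fact κ.IsRegular]

/-- A small `κ`-filtered category receives a final functor from a `κ`-directed poset, so arbitrary
small `κ`-filtered categories may serve as shapes from here on. -/
lemma _root_.directedColimits_iff (P : ObjectProperty C) (X : C) :
    directedColimits κ P X ↔ ∃ (J : Type w) (_ : SmallCategory J) (_ : IsCardinalFiltered J κ),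
      P.colimitsOfShape J X := by
  refine ⟨fun ⟨J, _, _, h⟩ ↦ ⟨J, inferInstance, inferInstance, h⟩, fun ⟨J, _, _, ⟨h⟩⟩ ↦ ?_⟩
  obtain ⟨α, _, _, F, _⟩ := IsCardinalFiltered.exists_cardinal_directed J κ
  exact ⟨α, inferInstance, inferInstance, ⟨h.reindex F⟩⟩

/-- A full subcategory of a `κ`-filtered category is `κ`-filtered if any object maps to an object
of the subcategory. -/
lemma IsCardinalFiltered.of_exists_of_fullyFaithful {D E : Type*} [Category* D] [Category* E]
    (F : D ⥤ E) [F.Full] [F.Faithful] [IsCardinalFiltered E κ]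
    (h : ∀ e, ∃ d, Nonempty (e ⟶ F.obj d)) : IsCardinalFiltered D κ where
  nonempty_cocone {K _} G hK := ⟨by
    let c := IsCardinalFiltered.cocone (G ⋙ F) hK
    let d := (h c.pt).choose
    let u : c.pt ⟶ F.obj d := (h c.pt).choose_spec.some
    exact
      { pt := d
        ι :=
          { app k := F.preimage (c.ι.app k ≫ u)
            naturality k k' g := F.map_injective (by
              have := c.w g
              dsimp at this
              simp [reassoc_of% this]) } }⟩

end

/-- Let `X` be a `κ`-filtered colimit of `κ`-presentable objects. If any morphism from an object
of the diagram to `X` factors through an object of a class `P` of `κ`-presentable objects,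
then `X` is a `κ`-filtered colimit of objects from `P`. -/
lemma exists_colimitsOfShape_of_factors
    {C : Type u} [Category.{w} C] {κ : Cardinal.{w}} [Fact κ.IsRegular]
    {J : Type w} [SmallCategory J] [IsCardinalFiltered J κ] {X : C}
    (p : (isCardinalPresentable C κ).ColimitOfShape J X) (P : ObjectProperty C)
    (hP : P ≤ isCardinalPresentable C κ)
    (h : ∀ j, ∃ (Y : C) (_ : P Y) (a : p.diag.obj j ⟶ Y) (b : Y ⟶ X), a ≫ b = p.ι.app j) :
    ∃ (J' : Type w) (_ : SmallCategory J') (_ : IsCardinalFiltered J' κ),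
      P.colimitsOfShape J' X := by
  choose Y hY a b hab using h
  have := essentiallySmallSelf J
  let E := CostructuredArrow (isCardinalPresentable C κ).ι X
  let φ : J → E := fun j ↦ CostructuredArrow.mk (Y := ⟨Y j, hP _ (hY j)⟩) (by exact b j)
  -- The diagram is final in the category `E` of all `κ`-presentables over `X`, so `E` inherits
  -- `κ`-filteredness, and `X` is also the colimit over `E`.
  have hE : IsCardinalFiltered E κ := IsCardinalFiltered.of_final p.toCostructuredArrow κ
  have := isFiltered_of_isCardinalFiltered E κ
  have hφ (e : E) : ∃ d, Nonempty (e ⟶ (inducedFunctor φ).obj d) := by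
    obtain ⟨j, g, hg⟩ := IsCardinalPresentable.exists_hom_of_isColimit κ p.isColimit e.hom
    exact ⟨j, ⟨CostructuredArrow.homMk (ObjectProperty.homMk (g ≫ a j))
      (by dsimp [φ] at hg ⊢; simp [hab, hg])⟩⟩
  have hc : IsColimit ((Functor.LeftExtension.mk (𝟭 C)
      (isCardinalPresentable C κ).ι.rightUnitor.inv).coconeAt X) :=
    (Functor.Final.isColimitWhiskerEquiv (F := p.toCostructuredArrow) _).1
      (IsColimit.ofIsoColimit p.isColimit (Cocone.ext (Iso.refl _) fun j ↦
        (Category.comp_id (p.ι.app j)).trans (Category.id_comp (p.ι.app j)).symm))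
  have := Functor.final_of_exists_of_isFiltered_of_fullyFaithful (inducedFunctor φ) hφ
  have hJ' := IsCardinalFiltered.of_exists_of_fullyFaithful (κ := κ) (inducedFunctor φ) hφ
  -- The full subcategory of `E` on the chosen factorizations is indexed by `J`, hence small; by
  -- `hφ` it is final in `E`.
  exact ⟨InducedCategory E φ, inferInstance, hJ', ⟨
    { diag := _
      ι := _
      isColimit := (Functor.Final.isColimitWhiskerEquiv (F := inducedFunctor φ) _).2 hc
      prop_diag_obj j := hY j }⟩⟩

end CategoryTheory

/-! ### Diagrams of shape `C ⟶ D ⇉ K` -/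

namespace SeqShape

variable {C : Type u} [Category.{v} C]

/-- The diagram given by a morphism `m : X ⟶ Y` and a pair `k₁, k₂ : Y ⟶ K` coequalizing it. -/
def functor {X Y K : C} (m : X ⟶ Y) (k₁ k₂ : Y ⟶ K) (h : m ≫ k₁ = m ≫ k₂) : SeqShape ⥤ C where
  obj
    | one => X
    | two => Y
    | three => K
  map {a b} (f : Hom a b) := match a, b, f with
    | _, _, .id _ => 𝟙 _
    | _, _, .m => m
    | _, _, .k₁ => k₁
    | _, _, .k₂ => k₂
    | _, _, .c => m ≫ k₁
  map_id _ := rfl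
  map_comp {a b c} (f : Hom a b) (g : Hom b c) := by
    cases f with
    | id => exact (Category.id_comp _).symm
    | m =>
      cases g with
      | id => exact (Category.comp_id _).symm
      | k₁ => rfl
      | k₂ => exact h
    | k₁ => cases g; exact (Category.comp_id _).symm
    | k₂ => cases g; exact (Category.comp_id _).symm
    | c => cases g; exact (Category.comp_id _).symm

/-- A family of morphisms compatible with the generating morphisms of `SeqShape` is natural. -/
def natTransMk {F G : SeqShape ⥤ C} (α : ∀ X, F.obj X ⟶ G.obj X)
    (hm : F.map homM ≫ α two = α one ≫ G.map homM)
    (h₁ : F.map homK₁ ≫ α three = α two ≫ G.map homK₁)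
    (h₂ : F.map homK₂ ≫ α three = α two ≫ G.map homK₂) : F ⟶ G where
  app := α
  naturality a b (f : Hom a b) := by
    cases f with
    | id =>
      change F.map (𝟙 _) ≫ _ = _ ≫ G.map (𝟙 _)
      simp
    | m => exact hm
    | k₁ => exact h₁
    | k₂ => exact h₂
    | c =>
      change F.map (homM ≫ homK₁) ≫ _ = _ ≫ G.map (homM ≫ homK₁)
      simp [h₁, reassoc_of% hm]

/-- The functor sending a diagram `C ⟶ D ⇉ K` to the morphism `C ⟶ D`. -/
def arrowFunctor : (SeqShape ⥤ C) ⥤ Arrow C where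
  obj F := Arrow.mk (F.map homM)
  map τ := Arrow.homMk (τ.app one) (τ.app two)

instance (J : Type*) [Category* J] [HasColimitsOfShape J C] :
    PreservesColimitsOfShape J (arrowFunctor (C := C)) :=
  ⟨⟨fun hc ↦ ⟨Arrow.isColimitOfLeftRight
    (isColimitOfPreserves ((evaluation SeqShape C).obj one) hc)
    (isColimitOfPreserves ((evaluation SeqShape C).obj two) hc)⟩⟩⟩

/-- A colimit presentation of a diagram `C ⟶ D ⇉ K` from termwise colimit presentations. -/
def colimitPresentation {J : Type*} [Category* J] {F : SeqShape ⥤ C} {S T P : J ⥤ C}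
    (m : S ⟶ T) (i j : T ⟶ P) (h : m ≫ i = m ≫ j)
    {ιS : S ⟶ (Functor.const J).obj (F.obj one)} (hS : IsColimit (Cocone.mk _ ιS))
    {ιT : T ⟶ (Functor.const J).obj (F.obj two)} (hT : IsColimit (Cocone.mk _ ιT))
    {ιP : P ⟶ (Functor.const J).obj (F.obj three)} (hP : IsColimit (Cocone.mk _ ιP))
    (hm : ∀ k, ιS.app k ≫ F.map homM = m.app k ≫ ιT.app k)
    (hi : ∀ k, ιT.app k ≫ F.map homK₁ = i.app k ≫ ιP.app k)
    (hj : ∀ k, ιT.app k ≫ F.map homK₂ = j.app k ≫ ιP.app k) :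
    ColimitPresentation J F where
  diag := (functor m i j h).flip
  ι :=
    { app k := natTransMk
        (fun
          | one => ιS.app k
          | two => ιT.app k
          | three => ιP.app k)
        (hm k).symm (hi k).symm (hj k).symm
      naturality k k' g := by
        ext X
        cases X
        · exact ιS.naturality g
        · exact ιT.naturality g
        · exact ιP.naturality g }
  isColimit := evaluationJointlyReflectsColimits _ fun
    | one => hS
    | two => hT
    | three => hP

end SeqShape

/-! ### Approximation by `κ`-presentable objects -/

variable {A : Type u} [Category.{w} A] {κ : Cardinal.{w}} [Fact κ.IsRegular]

/-- The class of all morphisms from `N`, as a class of objects of the category of morphisms. -/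
def presentableArrows (N : MorphismProperty (PresentableObjects A κ)) :
    ObjectProperty (Arrow A) := fun g ↦
  ∃ (hl : isCardinalPresentable A κ g.left) (hr : isCardinalPresentable A κ g.right),
    N (ObjectProperty.homMk g.hom : (⟨g.left, hl⟩ : PresentableObjects A κ) ⟶ ⟨g.right, hr⟩)

lemma directedColimitsOfMorphisms_iff (N : MorphismProperty (PresentableObjects A κ))
    {X Y : A} (f : X ⟶ Y) : directedColimitsOfMorphisms κ N f ↔
      ∃ (J : Type w) (_ : SmallCategory J) (_ : IsCardinalFiltered J κ),
        (presentableArrows N).colimitsOfShape J (Arrow.mk f) :=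
  directedColimits_iff _ _

lemma isCardinalPresentable_of_isPushout {X Y X' Y' : A} {m : X ⟶ Y} {f : X ⟶ X'} {f' : Y ⟶ Y'}
    {m' : X' ⟶ Y'} (sq : IsPushout m f f' m') (hX : isCardinalPresentable A κ X)
    (hY : isCardinalPresentable A κ Y) (hX' : isCardinalPresentable A κ X') :
    isCardinalPresentable A κ Y' := by
  have (k : WalkingSpan) : IsCardinalPresentable ((span m f).obj k) κ := by
    obtain _ | _ | _ := k
    exacts [hX, hY, hX']
  refine isCardinalPresentable_of_isColimit _ sq.isColimit κ ?_
  -- A span is a finite shape and a regular cardinal is infinite.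
  refine HasCardinalLT.of_le ?_ (Cardinal.IsRegular.aleph0_le Fact.out)
  rw [hasCardinalLT_aleph0_iff]
  infer_instance

/-- Given `κ`-filtered colimit presentations of `X` and `Y`, a morphism `X ⟶ Y` is a colimit of
morphisms between objects of the two diagrams. -/
lemma exists_natTrans_of_colimitOfShape {I J : Type w} [SmallCategory I] [SmallCategory J]
    [IsCardinalFiltered I κ] [IsCardinalFiltered J κ] {X Y : A}
    (p : (isCardinalPresentable A κ).ColimitOfShape I X)
    (q : (isCardinalPresentable A κ).ColimitOfShape J Y) (f : X ⟶ Y) :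
    ∃ (K : Type w) (_ : SmallCategory K) (_ : IsCardinalFiltered K κ) (a : K ⥤ I) (b : K ⥤ J)
      (_ : a.Final) (_ : b.Final) (φ : a ⋙ p.diag ⟶ b ⋙ q.diag),
      ∀ k, φ.app k ≫ q.ι.app (b.obj k) = p.ι.app (a.obj k) ≫ f := by
  have := isFiltered_of_isCardinalFiltered I κ
  have := isFiltered_of_isCardinalFiltered J κ
  have := essentiallySmallSelf J
  -- An object of `Comma L R` is a pair of indices `i`, `j` with a morphism between the
  -- corresponding objects compatible with `f`.
  let L := p.toCostructuredArrow ⋙ CostructuredArrow.map f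
  let R := q.toCostructuredArrow
  have : R.Final := inferInstance
  exact ⟨Comma L R, inferInstance, Comma.isCardinalFiltered_of_final L R κ, Comma.fst L R,
    Comma.snd L R, inferInstance, inferInstance,
    { app k := k.hom.left.hom
      naturality k k' g := congr_arg (fun t ↦ t.left.hom) g.w },
    fun k ↦ CostructuredArrow.w k.hom⟩

variable [IsCardinalAccessibleCategory A κ]

lemma exists_colimitOfShape_isCardinalPresentable (κ : Cardinal.{w}) [Fact κ.IsRegular]
    [IsCardinalAccessibleCategory A κ] (X : A) :
    ∃ (J : Type w) (_ : SmallCategory J) (_ : IsCardinalFiltered J κ),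
      Nonempty ((isCardinalPresentable A κ).ColimitOfShape J X) :=
  (isCardinalFilteredGenerator_isCardinalPresentable A κ).exists_colimitsOfShape X

/-- Any morphism is a `κ`-filtered colimit of morphisms between `κ`-presentable objects. -/
lemma exists_colimitOfShape_arrow (f : Arrow A) :
    ∃ (J : Type w) (_ : SmallCategory J) (_ : IsCardinalFiltered J κ)
      (p : (isCardinalPresentable (Arrow A) κ).ColimitOfShape J f),
      ∀ j, isCardinalPresentable A κ (p.diag.obj j).left ∧
        isCardinalPresentable A κ (p.diag.obj j).right := by
  obtain ⟨I, _, _, ⟨p⟩⟩ := exists_colimitOfShape_isCardinalPresentable κ f.left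
  obtain ⟨J, _, _, ⟨q⟩⟩ := exists_colimitOfShape_isCardinalPresentable κ f.right
  obtain ⟨K, _, _, a, b, _, _, φ, hφ⟩ := exists_natTrans_of_colimitOfShape p q f.hom
  have hl (k : K) : IsCardinalPresentable (p.diag.obj (a.obj k)) κ := p.prop_diag_obj _
  have hr (k : K) : IsCardinalPresentable (q.diag.obj (b.obj k)) κ := q.prop_diag_obj _
  refine ⟨K, inferInstance, inferInstance,
    { toColimitPresentation := Arrow.colimitPresentation φ (p.reindex a).isColimit
        (q.reindex b).isColimit (m' := f.hom) fun k ↦ (hφ k).symm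
      prop_diag_obj k := ?_ }, fun k ↦ ⟨hl k, hr k⟩⟩
  have : IsCardinalPresentable (Arrow.mk (φ.app k)).left κ := hl k
  have : IsCardinalPresentable (Arrow.mk (φ.app k)).right κ := hr k
  exact Arrow.isCardinalPresentable (Arrow.mk (φ.app k))

/-- A morphism `f` is a `κ`-directed colimit of morphisms from `N` if and only if any morphism to
`f` from a morphism of `κ`-presentable objects factors through a morphism from `N`. -/
lemma directedColimitsOfMorphisms_iff_factors (N : MorphismProperty (PresentableObjects A κ))
    {X Y : A} (f : X ⟶ Y) : directedColimitsOfMorphisms κ N f ↔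
      ∀ {U V : A} (h : U ⟶ V) (_ : isCardinalPresentable A κ U) (_ : isCardinalPresentable A κ V)
        (s : U ⟶ X) (t : V ⟶ Y) (_ : s ≫ f = h ≫ t),
        ∃ (S T : PresentableObjects A κ) (n : S ⟶ T) (_ : N n) (a : U ⟶ S.obj) (b : V ⟶ T.obj)
          (c : S.obj ⟶ X) (d : T.obj ⟶ Y), a ≫ n.hom = h ≫ b ∧ c ≫ f = n.hom ≫ d ∧
            a ≫ c = s ∧ b ≫ d = t := by
  rw [directedColimitsOfMorphisms_iff]
  constructor
  · rintro ⟨J, _, _, ⟨p⟩⟩ U V h hU hV s t w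
    have : IsCardinalPresentable (Arrow.mk h).left κ := hU
    have : IsCardinalPresentable (Arrow.mk h).right κ := hV
    have := Arrow.isCardinalPresentable (κ := κ) (Arrow.mk h)
    have := essentiallySmallSelf J
    obtain ⟨j, g, hg⟩ := IsCardinalPresentable.exists_hom_of_isColimit κ p.isColimit
      (Arrow.homMk s t w : Arrow.mk h ⟶ Arrow.mk f)
    obtain ⟨hl, hr, hn⟩ := p.prop_diag_obj j
    exact ⟨_, _, _, hn, g.left, g.right, (p.ι.app j).left, (p.ι.app j).right, Arrow.w g,
      Arrow.w (p.ι.app j), congr_arg CommaMorphism.left hg, congr_arg CommaMorphism.right hg⟩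
  · intro H
    obtain ⟨J, _, _, p, hp⟩ := exists_colimitOfShape_arrow (κ := κ) (Arrow.mk f)
    -- The criterion is only needed for the arrows of one presentation of `f`.
    refine exists_colimitsOfShape_of_factors p (presentableArrows N) ?_ fun j ↦ ?_
    · rintro g ⟨hl, hr, -⟩
      have : IsCardinalPresentable g.left κ := hl
      have : IsCardinalPresentable g.right κ := hr
      exact Arrow.isCardinalPresentable g
    · obtain ⟨S, T, n, hn, a, b, c, d, h₁, h₂, h₃, h₄⟩ := H (p.diag.obj j).hom (hp j).1 (hp j).2
        (p.ι.app j).left (p.ι.app j).right (Arrow.w (p.ι.app j))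
      refine ⟨Arrow.mk n.hom, ⟨S.property, T.property, hn⟩, Arrow.homMk a b h₁,
        Arrow.homMk c d h₂, ?_⟩
      ext
      · exact h₃
      · exact h₄

/-- The inclusion of the full subcategory of `κ`-presentable objects preserves pushouts. -/
lemma isPushout_map_ι {X Y X' Y' : PresentableObjects A κ} {m : X ⟶ Y} {f : X ⟶ X'}
    {f' : Y ⟶ Y'} {m' : X' ⟶ Y'} (sq : IsPushout m f f' m') :
    IsPushout m.hom f.hom f'.hom m'.hom where
  w := congr_arg InducedCategory.Hom.hom sq.w
  isColimit' := by
    -- Any `Z` is a `κ`-filtered colimit of `κ`-presentables, so maps to `Z` from the corners of the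
    -- square, and equations between them, live at a stage, where the universal property in the
    -- subcategory applies.
    have ext {Z : A} (a b : Y'.obj ⟶ Z) (h₁ : f'.hom ≫ a = f'.hom ≫ b)
        (h₂ : m'.hom ≫ a = m'.hom ≫ b) : a = b := by
      obtain ⟨J, _, _, ⟨p⟩⟩ := exists_colimitOfShape_isCardinalPresentable κ Z
      have := essentiallySmallSelf J
      have := isFiltered_of_isCardinalFiltered J κ
      obtain ⟨i₁, a', rfl⟩ := IsCardinalPresentable.exists_hom_of_isColimit κ p.isColimit a
      obtain ⟨i₂, b', rfl⟩ := IsCardinalPresentable.exists_hom_of_isColimit κ p.isColimit b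
      obtain ⟨j₁, u₁, v₁, e₁⟩ := IsCardinalPresentable.exists_eq_of_isColimit κ p.isColimit
        (f'.hom ≫ a') (f'.hom ≫ b') (by simpa using h₁)
      obtain ⟨j₂, u₂, v₂, e₂⟩ := IsCardinalPresentable.exists_eq_of_isColimit κ p.isColimit
        (m'.hom ≫ a') (m'.hom ≫ b') (by simpa using h₂)
      -- The two equations hold at different stages; a bowtie brings both to `k` along the same pair
      -- of transition maps.
      obtain ⟨k, s, t, hs, ht⟩ := IsFiltered.bowtie u₁ u₂ v₁ v₂
      have : a' ≫ p.diag.map (u₁ ≫ s) = b' ≫ p.diag.map (v₁ ≫ s) := by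
        let Z' : PresentableObjects A κ := ⟨p.diag.obj k, p.prop_diag_obj k⟩
        let α : Y' ⟶ Z' := ObjectProperty.homMk (a' ≫ p.diag.map (u₁ ≫ s))
        let β : Y' ⟶ Z' := ObjectProperty.homMk (b' ≫ p.diag.map (v₁ ≫ s))
        refine congr_arg InducedCategory.Hom.hom (sq.hom_ext ?_ ?_ : α = β)
        · ext
          have := e₁ =≫ p.diag.map s
          simpa [α, β] using this
        · ext
          have := e₂ =≫ p.diag.map t
          simpa [α, β, hs, ht] using this
      have := this =≫ p.ι.app k
      simpa only [Category.assoc, p.w] using this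
    have ex {Z : A} (a : Y.obj ⟶ Z) (b : X'.obj ⟶ Z) (h : m.hom ≫ a = f.hom ≫ b) :
        ∃ d : Y'.obj ⟶ Z, f'.hom ≫ d = a ∧ m'.hom ≫ d = b := by
      obtain ⟨J, _, _, ⟨p⟩⟩ := exists_colimitOfShape_isCardinalPresentable κ Z
      have := essentiallySmallSelf J
      obtain ⟨i₁, a', rfl⟩ := IsCardinalPresentable.exists_hom_of_isColimit κ p.isColimit a
      obtain ⟨i₂, b', rfl⟩ := IsCardinalPresentable.exists_hom_of_isColimit κ p.isColimit b
      obtain ⟨k, u, v, e⟩ := IsCardinalPresentable.exists_eq_of_isColimit κ p.isColimit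
        (m.hom ≫ a') (f.hom ≫ b') (by simpa using h)
      let Z' : PresentableObjects A κ := ⟨p.diag.obj k, p.prop_diag_obj k⟩
      let d : Y' ⟶ Z' := sq.desc (ObjectProperty.homMk (a' ≫ p.diag.map u))
        (ObjectProperty.homMk (b' ≫ p.diag.map v)) (by ext; simpa using e)
      have hd₁ : f'.hom ≫ d.hom = a' ≫ p.diag.map u :=
        congr_arg InducedCategory.Hom.hom (sq.inl_desc _ _ _)
      have hd₂ : m'.hom ≫ d.hom = b' ≫ p.diag.map v :=
        congr_arg InducedCategory.Hom.hom (sq.inr_desc _ _ _)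
      exact ⟨d.hom ≫ p.ι.app k, by simp [reassoc_of% hd₁], by simp [reassoc_of% hd₂]⟩
    choose d hd₁ hd₂ using fun s : PushoutCocone m.hom f.hom ↦ ex s.inl s.inr s.condition
    exact ⟨PushoutCocone.IsColimit.mk _ d hd₁ hd₂ fun s t h₁ h₂ ↦
      ext _ _ (h₁.trans (hd₁ s).symm) (h₂.trans (hd₂ s).symm)⟩

variable {A : Type u} [Category.{w} A] {κ : Cardinal.{w}} [Fact κ.IsRegular]

lemma isPushout_of_map_ι {X Y X' Y' : PresentableObjects A κ} {m : X ⟶ Y} {f : X ⟶ X'}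
    {f' : Y ⟶ Y'} {m' : X' ⟶ Y'} (sq : IsPushout m.hom f.hom f'.hom m'.hom) :
    IsPushout m f f' m' :=
  IsPushout.of_map (isCardinalPresentable A κ).ι (by ext; exact sq.w) sq

/-! ### Cokernel pairs and equalizers under filtered colimits -/

/-- A colimit presentation of a morphism whose terms have cokernel pairs extends to a colimit
presentation of the diagram given by its cokernel pair. -/
lemma exists_colimitPresentation_seqShape {J : Type w} [SmallCategory J] [HasColimitsOfShape J A]
    {F : SeqShape ⥤ A}
    (sq : IsPushout (F.map SeqShape.homM) (F.map SeqShape.homM)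
      (F.map SeqShape.homK₁) (F.map SeqShape.homK₂))
    (p : ColimitPresentation J (Arrow.mk (F.map SeqShape.homM)))
    (h : ∀ j, HasPushout (p.diag.obj j).hom (p.diag.obj j).hom) :
    ∃ q : ColimitPresentation J F, ∀ j,
      Arrow.mk ((q.diag.obj j).map SeqShape.homM) = p.diag.obj j ∧
      IsPushout ((q.diag.obj j).map SeqShape.homM) ((q.diag.obj j).map SeqShape.homM)
        ((q.diag.obj j).map SeqShape.homK₁) ((q.diag.obj j).map SeqShape.homK₂) := by
  let m : p.diag ⋙ Arrow.leftFunc ⟶ p.diag ⋙ Arrow.rightFunc :=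
    Functor.whiskerLeft p.diag Arrow.leftToRight
  obtain ⟨P, i, j, hP⟩ := IsPushout.exists_functor m m h
  have hS := p.left.isColimit
  have hT := p.right.isColimit
  have w (k : J) : p.left.ι.app k ≫ F.map SeqShape.homM =
      m.app k ≫ p.right.ι.app k :=
    Arrow.w (p.ι.app k)
  obtain ⟨ι, hι, h₁, h₂⟩ := IsPushout.exists_isColimit hP hS hT hT sq w w
  exact ⟨SeqShape.colimitPresentation m i j (by ext k; exact (hP k).w) hS hT hι w h₁ h₂,
    fun k ↦ ⟨rfl, hP k⟩⟩

/-- `κ`-filtered colimits of cokernel pair diagrams are cokernel pair diagrams. -/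
lemma isPushout_of_colimitPresentation_seqShape {J : Type w} [SmallCategory J]
    [HasColimitsOfShape J A] {F : SeqShape ⥤ A} (p : ColimitPresentation J F)
    (h : ∀ j, IsPushout ((p.diag.obj j).map SeqShape.homM) ((p.diag.obj j).map SeqShape.homM)
        ((p.diag.obj j).map SeqShape.homK₁) ((p.diag.obj j).map SeqShape.homK₂)) :
    IsPushout (F.map SeqShape.homM) (F.map SeqShape.homM)
      (F.map SeqShape.homK₁) (F.map SeqShape.homK₂) := by
  let ev (X : SeqShape) := (evaluation SeqShape A).obj X
  let τ {X Y : SeqShape} (f : X ⟶ Y) : p.diag ⋙ ev X ⟶ p.diag ⋙ ev Y :=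
    Functor.whiskerLeft p.diag ((evaluation SeqShape A).map f)
  have w {X Y : SeqShape} (f : X ⟶ Y) (k : J) :
      (p.ι.app k).app X ≫ F.map f = (p.diag.obj k).map f ≫ (p.ι.app k).app Y :=
    ((p.ι.app k).naturality f).symm
  exact IsPushout.of_isColimit_app (m := τ SeqShape.homM) (f := τ SeqShape.homM)
    (i := τ SeqShape.homK₁) (j := τ SeqShape.homK₂) h
    (isColimitOfPreserves (ev .one) p.isColimit) (isColimitOfPreserves (ev .two) p.isColimit)
    (isColimitOfPreserves (ev .two) p.isColimit) (isColimitOfPreserves (ev .three) p.isColimit)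
    (w _) (w _) (w _) (w _)

/-- `κ`-filtered colimits of equalizers are equalizers. -/
lemma isLimit_fork_of_isColimit [IsCardinalAccessibleCategory A κ] {J : Type w} [SmallCategory J]
    [IsCardinalFiltered J κ] {S T P : J ⥤ A} {μ : S ⟶ T} {i j : T ⟶ P}
    (hw : ∀ k, μ.app k ≫ i.app k = μ.app k ≫ j.app k)
    (h : ∀ (k : J) {U : A} (_ : isCardinalPresentable A κ U) (u : U ⟶ T.obj k),
      u ≫ i.app k = u ≫ j.app k → ∃! l : U ⟶ S.obj k, l ≫ μ.app k = u)
    {cS : Cocone S} {cT : Cocone T} {cP : Cocone P}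
    (hS : IsColimit cS) (hT : IsColimit cT) (hP : IsColimit cP)
    {m : cS.pt ⟶ cT.pt} {k₁ k₂ : cT.pt ⟶ cP.pt}
    (hm : ∀ k, cS.ι.app k ≫ m = μ.app k ≫ cT.ι.app k)
    (h₁ : ∀ k, cT.ι.app k ≫ k₁ = i.app k ≫ cP.ι.app k)
    (h₂ : ∀ k, cT.ι.app k ≫ k₂ = j.app k ≫ cP.ι.app k) (w : m ≫ k₁ = m ≫ k₂) :
    Nonempty (IsLimit (Fork.ofι m w)) := by
  have := essentiallySmallSelf J
  have := isFiltered_of_isCardinalFiltered J κ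
  have mono {U : A} (hU : isCardinalPresentable A κ U) (l₁ l₂ : U ⟶ cS.pt)
      (hl : l₁ ≫ m = l₂ ≫ m) : l₁ = l₂ := by
    have : IsCardinalPresentable U κ := hU
    obtain ⟨j₁, a₁, rfl⟩ := IsCardinalPresentable.exists_hom_of_isColimit κ hS l₁
    obtain ⟨j₂, a₂, rfl⟩ := IsCardinalPresentable.exists_hom_of_isColimit κ hS l₂
    obtain ⟨k, u, v, e⟩ := IsCardinalPresentable.exists_eq_of_isColimit κ hT
      (a₁ ≫ μ.app j₁) (a₂ ≫ μ.app j₂) (by simpa only [Category.assoc, hm] using hl)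
    -- The map `(a₂ ≫ S.map v) ≫ μ.app k` equalizes the pair by `hw`, so its lift through `μ.app k`
    -- is unique.
    have := (h k hU ((a₂ ≫ S.map v) ≫ μ.app k) (by simp only [Category.assoc, hw])).unique
      (y₁ := a₁ ≫ S.map u) (by simpa using e) rfl
    simpa using this =≫ cS.ι.app k
  have ex {U : A} (hU : isCardinalPresentable A κ U) (t : U ⟶ cT.pt) (ht : t ≫ k₁ = t ≫ k₂) :
      ∃ l : U ⟶ cS.pt, l ≫ m = t := by
    have : IsCardinalPresentable U κ := hU
    obtain ⟨j₁, t', rfl⟩ := IsCardinalPresentable.exists_hom_of_isColimit κ hT t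
    obtain ⟨k, u, e⟩ := IsCardinalPresentable.exists_eq_of_isColimit' κ hP
      (t' ≫ i.app j₁) (t' ≫ j.app j₁) (by simpa only [Category.assoc, h₁, h₂] using ht)
    obtain ⟨l, hl, -⟩ := h k hU (t' ≫ T.map u) (by simpa using e)
    exact ⟨l ≫ cS.ι.app k, by rw [Category.assoc, hm, reassoc_of% hl, Cocone.w]⟩
  refine ⟨Fork.IsLimit.ofExistsUnique fun s ↦ ?_⟩
  obtain ⟨I, _, _, ⟨q⟩⟩ := exists_colimitOfShape_isCardinalPresentable κ s.pt
  choose l hl using fun i ↦ ex (q.prop_diag_obj i) (q.ι.app i ≫ s.ι)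
    (by simp only [Category.assoc, s.condition])
  -- The lifts on the `κ`-presentable pieces of `s.pt` are compatible by `mono`, hence glue.
  let c : Cocone q.diag :=
    { pt := cS.pt
      ι :=
        { app := l
          naturality i i' g := mono (q.prop_diag_obj i) _ _ (by simp [hl]) } }
  have hc (i : I) : q.ι.app i ≫ q.isColimit.desc c = l i := q.isColimit.fac c i
  refine ⟨q.isColimit.desc c, q.isColimit.hom_ext fun i ↦ ?_, fun t ht ↦
    q.isColimit.hom_ext fun i ↦ mono (q.prop_diag_obj i) _ _ ?_⟩
  · dsimp
    rw [reassoc_of% hc, hl]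
  · dsimp at ht ⊢
    rw [hc, hl, Category.assoc, ht]

/-! ### From `M` to its `κ`-presentable part -/

section Restriction

variable [IsCardinalAccessibleCategory A κ] {M : MorphismProperty A}

/-- Cokernel pairs of the terms are again `κ`-presentable, so a colimit of members of `M` between
`κ`-presentables extends to a colimit of `M`-sequences; coherence puts it in `M`. Conversely,
coherence presents the sequence of a member of `M`, and its first morphism gives the presentation.
-/
lemma IsQEMonoClass.directedColimits_restrict (hM : IsQEMonoClass M)
    (hc : IsLocallyCoherent κ M) :
    directedColimitsOfMorphisms κ (restrictToPresentable κ M) = M := by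
  ext X Y f
  rw [directedColimitsOfMorphisms_iff]
  constructor
  · rintro ⟨J, _, _, ⟨p⟩⟩
    have := HasCardinalFilteredColimits.hasColimitsOfShape A κ J
    have hp (j : J) : HasPushout (p.diag.obj j).hom (p.diag.obj j).hom := by
      obtain ⟨hl, hr, hj⟩ := p.prop_diag_obj j
      exact hM.hasPushout _ _ hj
    obtain ⟨P, i, j, hP⟩ := IsPushout.exists_functor
      (Functor.whiskerLeft p.diag Arrow.leftToRight)
      (Functor.whiskerLeft p.diag Arrow.leftToRight) hp
    have w (k : J) : p.left.ι.app k ≫ f =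
        (Functor.whiskerLeft p.diag Arrow.leftToRight).app k ≫
          p.right.ι.app k := 
      Arrow.w (p.ι.app k)
    have : HasPushout f f := IsPushout.hasPushout_of_isColimit hP
      p.left.isColimit p.right.isColimit
      p.right.isColimit w w
    let F := SeqShape.functor f _ _ (pushout.condition (f := f) (g := f))
    obtain ⟨q, hq⟩ := exists_colimitPresentation_seqShape (F := F) (.of_hasPushout f f)
      p.toColimitPresentation hp
    have : isMSequence M F := by
      rw [hc, directedColimits_iff]
      refine ⟨J, inferInstance, inferInstance, ⟨⟨q, fun j ↦ ?_⟩⟩⟩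
      obtain ⟨hj, sq⟩ := hq j
      obtain ⟨hl, hr, hn⟩ : presentableArrows (restrictToPresentable κ M)
        (Arrow.mk ((q.diag.obj j).map SeqShape.homM)) := hj ▸ p.prop_diag_obj j
      refine ⟨⟨hn, sq⟩, ?_⟩
      rintro (_ | _ | _)
      · exact hl
      · exact hr
      · exact isCardinalPresentable_of_isPushout sq hl hr hr
    exact this.1
  · intro hf
    have := hM.hasPushout f f hf
    let F := SeqShape.functor f _ _ (pushout.condition (f := f) (g := f))
    have hF : isMSequence M F := ⟨hf, .of_hasPushout f f⟩
    rw [hc, directedColimits_iff] at hF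
    obtain ⟨J, _, _, ⟨p⟩⟩ := hF
    have := HasCardinalFilteredColimits.hasColimitsOfShape A κ J
    exact ⟨J, inferInstance, inferInstance, ⟨
      { toColimitPresentation := p.toColimitPresentation.map SeqShape.arrowFunctor
        prop_diag_obj j := ⟨(p.prop_diag_obj j).2 _, (p.prop_diag_obj j).2 _,
          (p.prop_diag_obj j).1.1⟩ }⟩⟩

/-- Pushouts of `κ`-presentables in `A` are `κ`-presentable, and pushouts in the subcategory are
pushouts in `A`, so the axioms mean the same in both. -/
lemma IsQEMonoClass.restrict (hM : IsQEMonoClass M) :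
    IsQEMonoClass (restrictToPresentable κ M) where
  hasPushout {X Y X'} m f hm := by
    have : HasPushout m.hom f.hom := hM.hasPushout m.hom f.hom hm
    have sq := IsPushout.of_hasPushout m.hom f.hom
    let P : PresentableObjects A κ :=
      ⟨_, isCardinalPresentable_of_isPushout sq X.property Y.property X'.property⟩
    let f' : Y ⟶ P := ObjectProperty.homMk (pushout.inl m.hom f.hom)
    let m' : X' ⟶ P := ObjectProperty.homMk (pushout.inr m.hom f.hom)
    exact (isPushout_of_map_ι (f' := f') (m' := m') sq).hasPushout
  pushout_mem sq hm := hM.pushout_mem (isPushout_map_ι sq) hm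
  isEqualizer {X Y K m k₁ k₂} sq hm := by
    obtain ⟨h⟩ := hM.isEqualizer (isPushout_map_ι sq) hm
    refine ⟨Fork.IsLimit.ofExistsUnique fun s ↦ ?_⟩
    obtain ⟨l, hl, hl'⟩ := Fork.IsLimit.existsUnique h s.ι.hom
      (congr_arg InducedCategory.Hom.hom s.condition)
    exact ⟨ObjectProperty.homMk l, by ext; exact hl, fun t ht ↦ by
      ext; exact hl' _ (congr_arg InducedCategory.Hom.hom ht)⟩
  id_mem X := hM.id_mem X.obj
  comp_mem f g hf hg := hM.comp_mem f.hom g.hom hf hg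

/-- If `f` is a retract of `g`, every map to `f` factors through `g`, so the factorization criterion
applies. -/
lemma IsQEMonoClass.isStableUnderRetracts_restrict (hM : IsQEMonoClass M)
    (hc : IsLocallyCoherent κ M) : (restrictToPresentable κ M).IsStableUnderRetracts where
  of_retract {X Y Z W f g} r hg := by
    change M f.hom
    rw [← hM.directedColimits_restrict hc, directedColimitsOfMorphisms_iff_factors]
    intro U V h _ _ s t e
    have h₁ := congr_arg InducedCategory.Hom.hom (Arrow.w r.i)
    have h₂ := congr_arg InducedCategory.Hom.hom (Arrow.w r.r)
    have h₃ := congr_arg (fun φ ↦ φ.left.hom) r.retract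
    have h₄ := congr_arg (fun φ ↦ φ.right.hom) r.retract
    dsimp at h₁ h₂ h₃ h₄
    exact ⟨Z, W, g, hg, s ≫ r.i.left.hom, t ≫ r.i.right.hom, r.r.left.hom, r.r.right.hom,
      by rw [Category.assoc, h₁, reassoc_of% e], h₂, by rw [Category.assoc, h₃, Category.comp_id],
      by rw [Category.assoc, h₄, Category.comp_id]⟩

end Restriction

/-! ### From `N` to its `κ`-directed colimits -/

section Extension

variable {N : MorphismProperty (PresentableObjects A κ)}

lemma IsQEMonoClass.presentableArrows_of_isPushout (hN : IsQEMonoClass N) {X Y X' Y' : A}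
    {m : X ⟶ Y} {f : X ⟶ X'} {f' : Y ⟶ Y'} {m' : X' ⟶ Y'} (sq : IsPushout m f f' m')
    (hm : presentableArrows N (Arrow.mk m)) (hX' : isCardinalPresentable A κ X') :
    presentableArrows N (Arrow.mk m') := by
  obtain ⟨hX, hY, hm⟩ := hm
  exact ⟨hX', isCardinalPresentable_of_isPushout sq hX hY hX', hN.pushout_mem
    (isPushout_of_map_ι (f := ObjectProperty.homMk f) (f' := ObjectProperty.homMk f') sq) hm⟩

variable [IsCardinalAccessibleCategory A κ]

lemma IsQEMonoClass.hasPushout_of_presentableArrows (hN : IsQEMonoClass N) {X Y X' : A}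
    (m : X ⟶ Y) (f : X ⟶ X') (hm : presentableArrows N (Arrow.mk m))
    (hX' : isCardinalPresentable A κ X') : HasPushout m f := by
  obtain ⟨hX, hY, hm⟩ := hm
  let f₀ : (⟨X, hX⟩ : PresentableObjects A κ) ⟶ ⟨X', hX'⟩ := ObjectProperty.homMk f
  let m₀ : (⟨X, hX⟩ : PresentableObjects A κ) ⟶ ⟨Y, hY⟩ := ObjectProperty.homMk m
  have := hN.hasPushout m₀ f₀ hm
  exact (isPushout_map_ι (IsPushout.of_hasPushout m₀ f₀)).hasPushout

lemma restrict_directedColimits [N.IsStableUnderRetracts] :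
    restrictToPresentable κ (directedColimitsOfMorphisms κ N) = N := by
  ext X Y f
  change directedColimitsOfMorphisms κ N f.hom ↔ _
  rw [directedColimitsOfMorphisms_iff_factors]
  constructor
  · intro H
    -- Factoring the identity of `f` through `n` makes `f` a retract of `n`.
    obtain ⟨S, T, n, hn, a, b, c, d, h₁, h₂, h₃, h₄⟩ :=
      H f.hom X.property Y.property (𝟙 _) (𝟙 _) (by simp)
    refine N.of_retract
      { i := Arrow.homMk (ObjectProperty.homMk a) (ObjectProperty.homMk b) (by ext; exact h₁)
        r := Arrow.homMk (ObjectProperty.homMk c) (ObjectProperty.homMk d) (by ext; exact h₂)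
        retract := by
          ext
          · exact h₃
          · exact h₄ } hn
  · intro hf U V h hU hV s t e
    exact ⟨X, Y, f, hf, s, t, 𝟙 _, 𝟙 _, e, by simp, by simp, by simp⟩

/-- Pushouts of `κ`-directed colimits of morphisms from `N`. -/
lemma IsQEMonoClass.directedColimits_pushout (hN : IsQEMonoClass N) {X Y X' : A} (m : X ⟶ Y)
    (f : X ⟶ X') (hm : directedColimitsOfMorphisms κ N m) :
    HasPushout m f ∧ ∀ {Y' : A} {f' : Y ⟶ Y'} {m' : X' ⟶ Y'}, IsPushout m f f' m' →
      directedColimitsOfMorphisms κ N m' := by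
  rw [directedColimitsOfMorphisms_iff] at hm
  obtain ⟨I, _, _, ⟨p⟩⟩ := hm
  have := HasCardinalFilteredColimits.hasColimitsOfShape A κ I
  let pX : (isCardinalPresentable A κ).ColimitOfShape I X :=
    { toColimitPresentation := p.toColimitPresentation.left
      prop_diag_obj i := (p.prop_diag_obj i).1 }
  let pY : (isCardinalPresentable A κ).ColimitOfShape I Y :=
    { toColimitPresentation := p.toColimitPresentation.right
      prop_diag_obj i := (p.prop_diag_obj i).2.1 }
  obtain ⟨J, _, _, ⟨q⟩⟩ := exists_colimitOfShape_isCardinalPresentable κ X'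
  -- The presentations of `m` and of `X'` are brought to a common shape `K`. Reindexing along the
  -- final functor `a` keeps the terms of `m` in `N`.
  obtain ⟨K, _, _, a, b, _, _, φ, hφ⟩ := exists_natTrans_of_colimitOfShape pX q f
  have := HasCardinalFilteredColimits.hasColimitsOfShape A κ K
  let μ : a ⋙ pX.diag ⟶ a ⋙ pY.diag :=
    Functor.whiskerLeft a (Functor.whiskerLeft p.diag Arrow.leftToRight)
  obtain ⟨P, i, j, hP⟩ := IsPushout.exists_functor μ φ fun k ↦
    hN.hasPushout_of_presentableArrows _ _ (p.prop_diag_obj (a.obj k)) (q.prop_diag_obj _)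
  have w (k : K) : (pX.reindex a).ι.app k ≫ m = μ.app k ≫ (pY.reindex a).ι.app k :=
    Arrow.w (p.ι.app (a.obj k))
  have w' (k : K) : (pX.reindex a).ι.app k ≫ f = φ.app k ≫ (q.reindex b).ι.app k := (hφ k).symm
  refine ⟨IsPushout.hasPushout_of_isColimit hP (pX.reindex a).isColimit (pY.reindex a).isColimit
    (q.reindex b).isColimit w w', fun {Y' f' m'} sq ↦ ?_⟩
  obtain ⟨ι, hι, -, h₂⟩ := IsPushout.exists_isColimit hP (pX.reindex a).isColimit
    (pY.reindex a).isColimit (q.reindex b).isColimit sq w w'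
  rw [directedColimitsOfMorphisms_iff]
  exact ⟨K, inferInstance, inferInstance, ⟨
    { toColimitPresentation := Arrow.colimitPresentation j (q.reindex b).isColimit hι h₂
      prop_diag_obj k := hN.presentableArrows_of_isPushout (hP k) (p.prop_diag_obj (a.obj k))
        (q.prop_diag_obj _) }⟩⟩

/-- At each stage `N` gives an equalizer only within `A_{<κ}`; testing against `κ`-presentable
objects is all that `isLimit_fork_of_isColimit` asks for. -/
lemma IsQEMonoClass.directedColimits_isEqualizer (hN : IsQEMonoClass N) {X Y K : A} {m : X ⟶ Y}
    {k₁ k₂ : Y ⟶ K} (sq : IsPushout m m k₁ k₂) (hm : directedColimitsOfMorphisms κ N m) :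
    Nonempty (IsLimit (Fork.ofι m sq.w)) := by
  rw [directedColimitsOfMorphisms_iff] at hm
  obtain ⟨J, _, _, ⟨p⟩⟩ := hm
  have := HasCardinalFilteredColimits.hasColimitsOfShape A κ J
  let μ : p.diag ⋙ Arrow.leftFunc ⟶ p.diag ⋙ Arrow.rightFunc :=
    Functor.whiskerLeft p.diag Arrow.leftToRight
  obtain ⟨P, i, j, hP⟩ := IsPushout.exists_functor μ μ fun k ↦
    hN.hasPushout_of_presentableArrows _ _ (p.prop_diag_obj k) (p.prop_diag_obj k).2.1
  have hS := p.left.isColimit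
  have hT := p.right.isColimit
  have w (k : J) : p.left.ι.app k ≫ m =
      μ.app k ≫ p.right.ι.app k :=
    Arrow.w (p.ι.app k)
  obtain ⟨ι, hι, h₁, h₂⟩ := IsPushout.exists_isColimit hP hS hT hT sq w w
  refine isLimit_fork_of_isColimit (κ := κ) (fun k ↦ (hP k).w) (fun k U hU u hu ↦ ?_) hS hT hι
    w h₁ h₂ sq.w
  obtain ⟨hl, hr, hn⟩ := p.prop_diag_obj k
  let Z : PresentableObjects A κ :=
    ⟨P.obj k, isCardinalPresentable_of_isPushout (hP k) hl hr hr⟩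
  obtain ⟨h⟩ := hN.isEqualizer (isPushout_of_map_ι (Y' := Z)
    (f' := ObjectProperty.homMk (i.app k)) (m' := ObjectProperty.homMk (j.app k)) (hP k)) hn
  obtain ⟨l, hl, hl'⟩ := Fork.IsLimit.existsUnique h
    (ObjectProperty.homMk u : (⟨U, hU⟩ : PresentableObjects A κ) ⟶ _) (by ext; exact hu)
  exact ⟨l.hom, congr_arg InducedCategory.Hom.hom hl, fun t ht ↦
    congr_arg InducedCategory.Hom.hom (hl' (ObjectProperty.homMk t) (by ext; exact ht))⟩

lemma IsQEMonoClass.directedColimits_comp (hN : IsQEMonoClass N) {X Y Z : A} (f : X ⟶ Y)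
    (g : Y ⟶ Z) (hf : directedColimitsOfMorphisms κ N f)
    (hg : directedColimitsOfMorphisms κ N g) : directedColimitsOfMorphisms κ N (f ≫ g) := by
  rw [directedColimitsOfMorphisms_iff_factors] at hf hg ⊢
  intro U V h hU hV s t e
  obtain ⟨S, T, n, hn, a, b, c, d, h₁, h₂, h₃, rfl⟩ := hg h hU hV (s ≫ f) t (by simpa using e)
  -- First factor through `n : S ⟶ T` over `g`; then the square from `a : U ⟶ S` to `f` factors
  -- through `n'`, giving `b' : S ⟶ T'`. The pushout of `n` along `b'` makes the two composable.
  obtain ⟨S', T', n', hn', a', b', c', d', h₁', h₂', rfl, rfl⟩ := hf a hU S.property s c h₃.symm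
  have := hN.hasPushout n (ObjectProperty.homMk b') hn
  have sq := IsPushout.of_hasPushout n (ObjectProperty.homMk b')
  -- The induced map goes to `Z`, which need not be `κ`-presentable, so the universal property is
  -- needed in `A`.
  have sq' := isPushout_map_ι sq
  refine ⟨S', _, n' ≫ pushout.inr _ _, hN.comp_mem _ _ hn' (hN.pushout_mem sq hn), a',
    b ≫ (pushout.inl n (ObjectProperty.homMk b')).hom, c', sq'.desc d (d' ≫ g) ?_, ?_, ?_, rfl,
    ?_⟩
  · simpa using h₂.symm
  · have := sq'.w
    dsimp at this ⊢
    rw [reassoc_of% h₁', ← this, reassoc_of% h₁]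
  · simp [reassoc_of% h₂']
  · simp

lemma IsQEMonoClass.directedColimits (hN : IsQEMonoClass N) :
    IsQEMonoClass (directedColimitsOfMorphisms κ N) where
  hasPushout m f hm := (hN.directedColimits_pushout m f hm).1
  pushout_mem sq hm := (hN.directedColimits_pushout _ _ hm).2 sq
  isEqualizer sq hm := hN.directedColimits_isEqualizer sq hm
  id_mem X := by
    obtain ⟨J, _, _, ⟨p⟩⟩ := exists_colimitOfShape_isCardinalPresentable κ X
    rw [directedColimitsOfMorphisms_iff]
    exact ⟨J, inferInstance, inferInstance, ⟨
      { toColimitPresentation := Arrow.colimitPresentation (𝟙 p.diag) p.isColimit p.isColimit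
          (by simp)
        prop_diag_obj j := ⟨p.prop_diag_obj j, p.prop_diag_obj j, hN.id_mem _⟩ }⟩⟩
  comp_mem f g hf hg := hN.directedColimits_comp f g hf hg

/-- Closure under retracts ensures that a sequence with `κ`-presentable terms has its first morphism
in `N` itself, so a colimit of such sequences has its first morphism in the colimit closure of `N`.
-/
lemma IsQEMonoClass.isLocallyCoherent_directedColimits [N.IsStableUnderRetracts]
    (hN : IsQEMonoClass N) : IsLocallyCoherent κ (directedColimitsOfMorphisms κ N) := by
  ext F
  rw [directedColimits_iff]
  constructor
  · rintro ⟨hm, sq⟩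
    rw [directedColimitsOfMorphisms_iff] at hm
    obtain ⟨J, _, _, ⟨p⟩⟩ := hm
    have := HasCardinalFilteredColimits.hasColimitsOfShape A κ J
    obtain ⟨q, hq⟩ := exists_colimitPresentation_seqShape sq p.toColimitPresentation fun j ↦
      hN.hasPushout_of_presentableArrows _ _ (p.prop_diag_obj j) (p.prop_diag_obj j).2.1
    refine ⟨J, inferInstance, inferInstance, ⟨⟨q, fun j ↦ ?_⟩⟩⟩
    obtain ⟨hj, sq⟩ := hq j
    obtain ⟨hl, hr, hn⟩ : presentableArrows N
      (Arrow.mk ((q.diag.obj j).map SeqShape.homM)) := hj ▸ p.prop_diag_obj j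
    refine ⟨⟨?_, sq⟩, ?_⟩
    · rwa [← restrict_directedColimits (N := N)] at hn
    · rintro (_ | _ | _)
      · exact hl
      · exact hr
      · exact isCardinalPresentable_of_isPushout sq hl hr hr
  · rintro ⟨J, _, _, ⟨p⟩⟩
    have := HasCardinalFilteredColimits.hasColimitsOfShape A κ J
    refine ⟨?_, isPushout_of_colimitPresentation_seqShape p.toColimitPresentation
      fun j ↦ (p.prop_diag_obj j).1.2⟩
    rw [directedColimitsOfMorphisms_iff]
    refine ⟨J, inferInstance, inferInstance, ⟨
      { toColimitPresentation := p.toColimitPresentation.map SeqShape.arrowFunctor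
        prop_diag_obj j := ⟨(p.prop_diag_obj j).2 _, (p.prop_diag_obj j).2 _, ?_⟩ }⟩⟩
    have h : restrictToPresentable κ (directedColimitsOfMorphisms κ N)
      (ObjectProperty.homMk ((p.diag.obj j).map SeqShape.homM) :
        (⟨_, (p.prop_diag_obj j).2 _⟩ : PresentableObjects A κ) ⟶
          ⟨_, (p.prop_diag_obj j).2 _⟩) := (p.prop_diag_obj j).1.1
    rwa [restrict_directedColimits] at h

end Extension

/-! ### The bijection -/

theorem corollary7p2 {A : Type u} [Category.{w} A] (κ : Cardinal.{w}) [Fact κ.IsRegular]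
    [IsCardinalAccessibleCategory A κ] :
    Set.BijOn (restrictToPresentable κ)
        {M : MorphismProperty A | IsQEMonoClass M ∧ IsLocallyCoherent κ M}
        {N : MorphismProperty (PresentableObjects A κ) |
          IsQEMonoClass N ∧ N.IsStableUnderRetracts} ∧
      Set.BijOn (directedColimitsOfMorphisms κ)
        {N : MorphismProperty (PresentableObjects A κ) |
          IsQEMonoClass N ∧ N.IsStableUnderRetracts}
        {M : MorphismProperty A | IsQEMonoClass M ∧ IsLocallyCoherent κ M} ∧
      Set.InvOn (directedColimitsOfMorphisms κ) (restrictToPresentable κ)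
        {M : MorphismProperty A | IsQEMonoClass M ∧ IsLocallyCoherent κ M}
        {N : MorphismProperty (PresentableObjects A κ) |
          IsQEMonoClass N ∧ N.IsStableUnderRetracts} := by
  have hr : Set.MapsTo (restrictToPresentable κ)
      {M : MorphismProperty A | IsQEMonoClass M ∧ IsLocallyCoherent κ M}
      {N : MorphismProperty (PresentableObjects A κ) |
        IsQEMonoClass N ∧ N.IsStableUnderRetracts} := fun M ⟨hM, hc⟩ ↦
    ⟨hM.restrict, hM.isStableUnderRetracts_restrict hc⟩
  have hd : Set.MapsTo (directedColimitsOfMorphisms κ)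
      {N : MorphismProperty (PresentableObjects A κ) |
        IsQEMonoClass N ∧ N.IsStableUnderRetracts}
      {M : MorphismProperty A | IsQEMonoClass M ∧ IsLocallyCoherent κ M} := fun N ⟨hN, _⟩ ↦
    ⟨hN.directedColimits, hN.isLocallyCoherent_directedColimits⟩
  have hinv : Set.InvOn (directedColimitsOfMorphisms κ) (restrictToPresentable κ)
      {M : MorphismProperty A | IsQEMonoClass M ∧ IsLocallyCoherent κ M}
      {N : MorphismProperty (PresentableObjects A κ) |
        IsQEMonoClass N ∧ N.IsStableUnderRetracts} :=
    ⟨fun M ⟨hM, hc⟩ ↦ hM.directedColimits_restrict hc, fun N ⟨_, _⟩ ↦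
      restrict_directedColimits⟩
  exact ⟨hinv.bijOn hr hd, hinv.symm.bijOn hd hr, hinv⟩
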